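/- For every integer $k\ge 3$ and every real $\varepsilon>0$ there exists $\beta=\beta(k,\varepsilon)>0$ such that the following holds for every Hilbert space $\mathcal H$ over $\mathbb K=\mathbb R$ or $\mathbb K=\mathbb C$. Let $T:\mathcal H^k\to\mathbb K$ be a continuous symmetric $k$-linear form with $\|T\|=1$, where $$\|T\|=\sup\{|T(w_1,\dots,w_k)| : \|w_1\|,\dots,\|w_k\|\le 1\},$$ and let $x_1,\dots,x_k\in\mathcal H$ be norm-one vectors with $|T(x_1,\dots,x_k)|>1-\beta$. Then there is a linear subspace $V\subseteq\operatorname{span}\{x_1,\dots,x_k\}$, with $\dim V\le 2$ if $\mathbb K=\mathbb R$ and $\dim V=1$ if $\mathbb K=\mathbb C$, such that $\operatorname{dist}(x_j,V)\le\varepsilon$ for every $j=1,\dots,k$. -/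

import Mathlib

universe u


/-- A continuous `k`-linear form is symmetric if its value does not change under
any permutation of its arguments. -/
def IsSymmForm {𝕜 H : Type*} [RCLike 𝕜] [NormedAddCommGroup H] [InnerProductSpace 𝕜 H] {k : ℕ}
    (T : ContinuousMultilinearMap 𝕜 (fun _ : Fin k => H) 𝕜) : Prop :=
  ∀ (σ : Equiv.Perm (Fin k)) (w : Fin k → H), T (fun i => w (σ i)) = T w

/-! Rotate `T` by a unit scalar so that its value at `x` is positive, take the real part and freeze
all but three arguments; this leaves a real symmetric trilinear contraction `F` with `F x y z ≈ 1`.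
A functional almost attaining its norm at a unit vector is almost a multiple of the inner product
with it. So `F x x z` and `F y y z` are both near `⟪x, y⟫`, and the normalized `u ∝ x + y`, `v ∝ x -
y`, which are orthogonal, satisfy `F u u z ≈ 1`, `F v v z ≈ -1`. These force `F z z z ≈ 2⟪u, z⟫² -
1` and `F z z z ≈ 1 - 2⟪v, z⟫²`, hence `⟪u, z⟫² + ⟪v, z⟫² ≈ 1`: `z` is almost in the plane of `x`
and `y`.

Over `ℂ`, `F (iu) (iu) z = -F u u z`, so `v = iu` is available and the plane is the complex line of
`u`. Thus `x + y` and `x - y` are both almost multiples of `z`, and so is `x`. -/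

/-- A symmetric real trilinear form of norm at most one. -/
structure IsSymmTrilinearContraction {E : Type*} [NormedAddCommGroup E] [Module ℝ E]
    (F : E → E → E → ℝ) : Prop where
  add : ∀ x x' y z, F (x + x') y z = F x y z + F x' y z
  smul : ∀ (r : ℝ) (x y z), F (r • x) y z = r * F x y z
  swap_left : ∀ x y z, F x y z = F y x z
  swap_right : ∀ x y z, F x y z = F x z y
  bound : ∀ x y z, |F x y z| ≤ ‖x‖ * ‖y‖ * ‖z‖

/-! ### Multilinear algebra of symmetric trilinear forms. -/

namespace IsSymmTrilinearContraction

section Module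

variable {E : Type*} [NormedAddCommGroup E] [Module ℝ E] {F : E → E → E → ℝ}

theorem neg (hF : IsSymmTrilinearContraction F) :
    IsSymmTrilinearContraction (fun x y z => -F x y z) where
  add x x' y z := by rw [hF.add]; ring
  smul r x y z := by rw [hF.smul]; ring
  swap_left x y z := by rw [hF.swap_left]
  swap_right x y z := by rw [hF.swap_right]
  bound x y z := by rw [abs_neg]; exact hF.bound x y z

theorem rotate (hF : IsSymmTrilinearContraction F) (x y z : E) : F x y z = F z x y := by
  rw [hF.swap_right, hF.swap_left]

theorem add_mid (hF : IsSymmTrilinearContraction F) (x y y' z : E) :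
    F x (y + y') z = F x y z + F x y' z := by
  rw [hF.swap_left, hF.add, hF.swap_left y, hF.swap_left y']

theorem smul_mid (hF : IsSymmTrilinearContraction F) (r : ℝ) (x y z : E) :
    F x (r • y) z = r * F x y z := by
  rw [hF.swap_left, hF.smul, hF.swap_left y]

theorem add_right (hF : IsSymmTrilinearContraction F) (x y z z' : E) :
    F x y (z + z') = F x y z + F x y z' := by
  rw [hF.swap_right, hF.add_mid, hF.swap_right x z, hF.swap_right x z']

theorem smul_right (hF : IsSymmTrilinearContraction F) (r : ℝ) (x y z : E) :
    F x y (r • z) = r * F x y z := by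
  rw [hF.swap_right, hF.smul_mid, hF.swap_right x z]

end Module

end IsSymmTrilinearContraction

/-- A functional bounded by `M` that almost attains its norm at the unit vector `u` is close to
`M` times the inner product with `u`. -/
theorem abs_sub_inner_le_of_almost_attained {E : Type*} [NormedAddCommGroup E]
    [InnerProductSpace ℝ E] (f : E → ℝ) (hadd : ∀ x y, f (x + y) = f x + f y)
    (hsmul : ∀ (r : ℝ) x, f (r • x) = r * f x) {M s : ℝ} (hM : M ≤ 4) (hM0 : 0 ≤ M) (hs : 0 < s)
    (hf : ∀ x, |f x| ≤ M * ‖x‖) {u y : E} (hu : ‖u‖ = 1) (hy : ‖y‖ = 1)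
    (h : M - s ^ 2 ≤ f u) : |f y - M * inner ℝ u y| ≤ 3 * s := by
  -- First variation: expand `f (u + t • y) ≤ M * ‖u + t • y‖` in `t`. The coefficient 2 is a bound
  -- for `M / 2`; then `t = ±s` gives `3 * s`.
  have key : ∀ t : ℝ, t * (f y - M * inner ℝ u y) ≤ s ^ 2 + 2 * t ^ 2 := by
    intro t
    have h1 : f (u + t • y) = f u + t * f y := by rw [hadd, hsmul]
    have h2 := (abs_le.mp (hf (u + t • y))).2
    have h3 : ‖u + t • y‖ ^ 2 = 1 + 2 * (t * inner ℝ u y) + t ^ 2 := by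
      rw [norm_add_sq_real, inner_smul_right, norm_smul, hu, hy, mul_one, Real.norm_eq_abs, sq_abs]
      ring
    have h4 : ‖u + t • y‖ ≤ 1 + t * inner ℝ u y + t ^ 2 / 2 := by
      nlinarith [sq_nonneg (‖u + t • y‖ - 1)]
    have h5 := mul_le_mul_of_nonneg_left h4 hM0
    nlinarith [mul_nonneg (sub_nonneg.mpr hM) (sq_nonneg t)]
  have h1 := key s
  have h2 := key (-s)
  rw [abs_le]
  constructor <;> nlinarith

/-! ### Almost extremal triples of a trilinear contraction. -/

namespace IsSymmTrilinearContraction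

variable {E : Type*} [NormedAddCommGroup E] [InnerProductSpace ℝ E] {F : E → E → E → ℝ}

theorem abs_sub_inner_le (hF : IsSymmTrilinearContraction F) {x y z w : E} {s : ℝ} (hs : 0 < s)
    (hx : ‖x‖ = 1) (hy : ‖y‖ = 1) (hz : ‖z‖ = 1) (hw : ‖w‖ = 1) (h : 1 - s ^ 2 ≤ F x y z) :
    |F w y z - inner ℝ x w| ≤ 3 * s := by
  have := abs_sub_inner_le_of_almost_attained (fun x => F x y z) (fun a b => hF.add a b y z)
    (fun r a => hF.smul r a y z) (M := 1) (by norm_num) (by norm_num) hs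
    (fun a => by simpa [hy, hz] using hF.bound a y z) hx hw h
  simpa using this

theorem apply_add_add (hF : IsSymmTrilinearContraction F) (x y z : E) :
    F (x + y) (x + y) z = F x x z + 2 * F x y z + F y y z := by
  rw [hF.add, hF.add_mid, hF.add_mid, hF.swap_left y x]; ring

theorem apply_sub_sub (hF : IsSymmTrilinearContraction F) (x y z : E) :
    F (x - y) (x - y) z = F x x z - 2 * F x y z + F y y z := by
  have : x - y = x + (-1 : ℝ) • y := by rw [neg_one_smul, sub_eq_add_neg]
  rw [this, hF.apply_add_add, hF.smul_mid, hF.smul_mid, hF.smul]; ring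

theorem apply_smul_smul (hF : IsSymmTrilinearContraction F) (r : ℝ) (x z : E) :
    F (r • x) (r • x) z = r ^ 2 * F x x z := by
  rw [hF.smul, hF.smul_mid]; ring

/-- If `F u u z` is almost maximal then `F z z z` is determined by the angle between `u`
and `z`. -/
theorem abs_cube_sub_le (hF : IsSymmTrilinearContraction F) {u z : E} {r : ℝ} (hr : 0 < r)
    (hr1 : r ≤ 1) (hu : ‖u‖ = 1) (hz : ‖z‖ = 1) (h : 1 - r ^ 4 / 64 ≤ F u u z) :
    |F z z z - (2 * inner ℝ u z ^ 2 - 1)| ≤ 4 * r := by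
  set s := r ^ 2 / 8 with hsdef
  have hs : 0 < s := by positivity
  have h' : 1 - s ^ 2 ≤ F u u z := by rw [hsdef]; linarith [show (r ^ 2 / 8) ^ 2 = r ^ 4 / 64 by ring]
  have hup : F u u z ≤ 1 := by simpa [hu, hz] using (abs_le.mp (hF.bound u u z)).2
  have huuu : |F u u u - inner ℝ z u| ≤ 3 * s := by
    refine hF.abs_sub_inner_le hs hz hu hu hu ?_
    rwa [← hF.rotate]
  have hzzu : |F z u z - inner ℝ u z| ≤ 3 * s := hF.abs_sub_inner_le hs hu hu hz hz h'
  rw [real_inner_comm] at huuu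
  have hm : ‖u + z‖ ^ 2 = 2 + 2 * inner ℝ u z := by rw [norm_add_sq_real, hu, hz]; ring
  have ha := abs_le.mp (abs_real_inner_le_norm u z)
  rw [hu, hz] at ha
  have e1 := hF.apply_add_add u z u
  have e2 := hF.apply_add_add u z z
  have c1 : F u z u = F u u z := hF.swap_right _ _ _
  have c2 : F z z u = F z u z := hF.swap_right _ _ _
  have c3 : F u z z = F z u z := hF.swap_left _ _ _
  rw [c1, c2] at e1
  rw [c3] at e2
  obtain ⟨h1, h2⟩ := abs_le.mp huuu
  obtain ⟨h3, h4⟩ := abs_le.mp hzzu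
  have hr2 : r ^ 2 ≤ r := by nlinarith
  have hs1 : s ≤ 1 := by rw [hsdef]; linarith
  have hss : s ^ 2 ≤ s := by nlinarith
  -- `F (u + z) (u + z) ·` almost attains its bound `‖u + z‖ ^ 2` at `u`, so its value at `z` is
  -- about `(2 + 2c) * c` with `c = ⟪u, z⟫`. Direct expansion gives about `1 + 2c + F z z z`.
  have hfin := abs_sub_inner_le_of_almost_attained (fun x => F (u + z) (u + z) x)
    (hF.add_right _ _)
    (fun t a => hF.smul_right t _ _ a) (M := ‖u + z‖ ^ 2) (by rw [hm]; linarith)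
    (by positivity) hr (fun a => by simpa [sq] using hF.bound (u + z) (u + z) a) hu hz
    (by
      rw [e1, hm]
      linarith)
  rw [e2, hm] at hfin
  obtain ⟨h5, h6⟩ := abs_le.mp hfin
  rw [abs_le]
  constructor <;> nlinarith

/-- Compare the two estimates of `F z z z` coming from `F` with `u` and from `-F` with `v`. -/
theorem one_sub_le_inner_sq_add_inner_sq (hF : IsSymmTrilinearContraction F) {u v z : E} {r : ℝ}
    (hr : 0 < r) (hr1 : r ≤ 1) (hu : ‖u‖ = 1) (hv : ‖v‖ = 1) (hz : ‖z‖ = 1)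
    (h : 1 - r ^ 4 / 64 ≤ F u u z) (h' : F v v z ≤ -(1 - r ^ 4 / 64)) :
    1 - 4 * r ≤ inner ℝ u z ^ 2 + inner ℝ v z ^ 2 := by
  have h1 := abs_le.mp (hF.abs_cube_sub_le hr hr1 hu hz h)
  have h2 := abs_le.mp (hF.neg.abs_cube_sub_le hr hr1 hv hz (by linarith))
  linarith [h1.1, h2.1, h1.2, h2.2]

/-- Moving `x` or `y` into the other's slot shows `F x x z ≈ ⟪x, y⟫ ≈ F y y z`; expanding the
squares costs at most `6 * s + 2 * s ^ 2`. -/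
theorem le_apply_add_add (hF : IsSymmTrilinearContraction F) {x y z : E} {s : ℝ} (hs : 0 < s)
    (hs1 : s ≤ 1) (hx : ‖x‖ = 1) (hy : ‖y‖ = 1) (hz : ‖z‖ = 1) (h : 1 - s ^ 2 ≤ F x y z) :
    ‖x + y‖ ^ 2 - 8 * s ≤ F (x + y) (x + y) z ∧
      F (x - y) (x - y) z ≤ -(‖x - y‖ ^ 2 - 8 * s) := by
  have h1 := abs_le.mp (hF.abs_sub_inner_le hs hx hy hz hy h)
  have h2 := abs_le.mp (hF.abs_sub_inner_le hs hy hx hz hx (by rwa [hF.swap_left]))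
  rw [real_inner_comm] at h2
  have hss : s ^ 2 ≤ s := by nlinarith
  rw [hF.apply_add_add, hF.apply_sub_sub, norm_add_sq_real, norm_sub_sq_real, hx, hy]
  constructor <;> linarith [h1.1, h1.2, h2.1, h2.2]

theorem le_apply_normalize (hF : IsSymmTrilinearContraction F) {w z : E} {ε r : ℝ} (hε : 0 < ε)
    (hw : ε ≤ ‖w‖) (h : ‖w‖ ^ 2 - ε ^ 2 * (r ^ 4 / 64) ≤ F w w z) :
    1 - r ^ 4 / 64 ≤ F (‖w‖⁻¹ • w) (‖w‖⁻¹ • w) z := by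
  have hw0 : 0 < ‖w‖ := hε.trans_le hw
  rw [hF.apply_smul_smul, inv_pow, ← div_eq_inv_mul, le_div_iff₀ (by positivity)]
  have : ε ^ 2 ≤ ‖w‖ ^ 2 := by gcongr
  nlinarith [show 0 ≤ r ^ 4 / 64 by positivity]

/-- Three unit vectors at which `F` is almost extremal are almost coplanar. -/
theorem exists_norm_sub_le {x y z : E} {ε : ℝ} (hF : IsSymmTrilinearContraction F)
    (hε : 0 < ε) (hε1 : ε ≤ 1) (hx : ‖x‖ = 1) (hy : ‖y‖ = 1) (hz : ‖z‖ = 1)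
    (hadd : ε ≤ ‖x + y‖) (hsub : ε ≤ ‖x - y‖)
    (h : 1 - (ε ^ 2 * ((ε ^ 2 / 4) ^ 4 / 64) / 8) ^ 2 ≤ F x y z) :
    ∃ a b : ℝ, ‖z - (a • x + b • y)‖ ≤ ε := by
  -- Makes `4 * r = ε ^ 2`, the allowed squared distance from `z` to its projection on the plane.
  set r := ε ^ 2 / 4 with hrdef
  have hr : 0 < r := by positivity
  have hr1 : r ≤ 1 := by rw [hrdef]; nlinarith
  have hr4 : r ^ 4 ≤ 1 := pow_le_one₀ hr.le hr1
  have hε2 : ε ^ 2 ≤ 1 := pow_le_one₀ hε.le hε1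
  have hs1 : ε ^ 2 * (r ^ 4 / 64) / 8 ≤ 1 := by
    nlinarith [mul_le_mul hε2 hr4 (by positivity) zero_le_one]
  obtain ⟨h1, h2⟩ := hF.le_apply_add_add (by positivity) hs1 hx hy hz h
  have h1' := hF.le_apply_normalize (r := r) (z := z) hε hadd (by linarith)
  have h2' := hF.neg.le_apply_normalize (r := r) (z := z) hε hsub (by linarith)
  have hp : ‖x + y‖ ≠ 0 := (hε.trans_le hadd).ne'
  have hm : ‖x - y‖ ≠ 0 := (hε.trans_le hsub).ne'
  set u := ‖x + y‖⁻¹ • (x + y) with hu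
  set v := ‖x - y‖⁻¹ • (x - y) with hv
  have hun : ‖u‖ = 1 := by rw [hu, norm_smul, norm_inv, norm_norm, inv_mul_cancel₀ hp]
  have hvn : ‖v‖ = 1 := by rw [hv, norm_smul, norm_inv, norm_norm, inv_mul_cancel₀ hm]
  have huv : inner ℝ u v = 0 := by
    rw [hu, hv, inner_smul_left, inner_smul_right, inner_add_left, inner_sub_right,
      inner_sub_right, real_inner_self_eq_norm_sq, real_inner_self_eq_norm_sq, hx, hy,
      real_inner_comm]
    ring
  clear_value u v
  have hkey := hF.one_sub_le_inner_sq_add_inner_sq hr hr1 hun hvn hz h1' (by linarith)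
  have hdist : ‖z - (inner ℝ u z • u + inner ℝ v z • v)‖ ≤ ε := by
    refine (sq_le_sq₀ (norm_nonneg _) hε.le).mp ?_
    have : ‖z - (inner ℝ u z • u + inner ℝ v z • v)‖ ^ 2
        = 1 - (inner ℝ u z ^ 2 + inner ℝ v z ^ 2) := by
      rw [norm_sub_sq_real, norm_add_sq_real, inner_add_right, norm_smul, norm_smul, hun, hvn, hz]
      simp only [inner_smul_left, inner_smul_right, huv, Real.norm_eq_abs, mul_one, sq_abs,
        real_inner_comm u z, real_inner_comm v z]
      simp
      ring
    rw [this]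
    linarith
  refine ⟨inner ℝ u z * ‖x + y‖⁻¹ + inner ℝ v z * ‖x - y‖⁻¹,
    inner ℝ u z * ‖x + y‖⁻¹ - inner ℝ v z * ‖x - y‖⁻¹, ?_⟩
  convert hdist using 3
  rw [hu, hv]
  module

end IsSymmTrilinearContraction

/-! ### Reduction from `k` arguments to three. -/

section MultilinearForm

variable {𝕜 H : Type*} [RCLike 𝕜] [NormedAddCommGroup H] [InnerProductSpace 𝕜 H] {k : ℕ}

theorem prod_norm_update_of_norm_eq_one {x : Fin k → H} (hx : ∀ i, ‖x i‖ = 1) {i j l : Fin k}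
    (hij : i ≠ j) (hil : i ≠ l) (hjl : j ≠ l) (a b c : H) :
    ∏ m, ‖Function.update (Function.update (Function.update x l c) j b) i a m‖
      = ‖a‖ * ‖b‖ * ‖c‖ := by
  rw [← Finset.prod_subset (Finset.subset_univ {i, j, l})]
  · rw [Finset.prod_insert (by simp [hij, hil]), Finset.prod_insert (by simp [hjl]),
      Finset.prod_singleton]
    simp [Function.update_of_ne, hij.symm, hil.symm, hjl.symm, mul_assoc]
  · intro m _ hm
    simp only [Finset.mem_insert, Finset.mem_singleton, not_or] at hm
    rw [Function.update_of_ne hm.1, Function.update_of_ne hm.2.1, Function.update_of_ne hm.2.2, hx]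

/-- Freezing all but three arguments of a symmetric form, rotating and taking the real part. -/
theorem IsSymmForm.isSymmTrilinearContraction [Module ℝ H] [IsScalarTower ℝ 𝕜 H]
    {T : ContinuousMultilinearMap 𝕜 (fun _ : Fin k => H) 𝕜} (hT : IsSymmForm T) (hn : ‖T‖ = 1)
    {x : Fin k → H} (hx : ∀ i, ‖x i‖ = 1) {i j l : Fin k}
    (hij : i ≠ j) (hil : i ≠ l) (hjl : j ≠ l) {ω : 𝕜} (hω : ‖ω‖ = 1) :
    IsSymmTrilinearContraction (fun a b c => RCLike.re
      (ω * T (Function.update (Function.update (Function.update x l c) j b) i a))) where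
  add a a' b c := by rw [T.map_update_add, mul_add, map_add]
  smul r a b c := by
    rw [RCLike.real_smul_eq_coe_smul (K := 𝕜), T.map_update_smul, smul_eq_mul, mul_left_comm,
      RCLike.re_ofReal_mul]
  swap_left a b c := by
    rw [← hT (Equiv.swap i j)]
    congr 3
    ext m
    rcases eq_or_ne m i with rfl | hi
    · simp [Function.update_of_ne hij.symm]
    rcases eq_or_ne m j with rfl | hj
    · simp [Function.update_of_ne hij.symm]
    rw [Equiv.swap_apply_of_ne_of_ne hi hj]
    simp [Function.update_of_ne, hi, hj]
  swap_right a b c := by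
    rw [← hT (Equiv.swap j l)]
    congr 3
    ext m
    rcases eq_or_ne m i with rfl | hi
    · rw [Equiv.swap_apply_of_ne_of_ne hij hil]; simp
    rcases eq_or_ne m j with rfl | hj
    · simp [Function.update_of_ne, hil.symm, hjl.symm, hi]
    rcases eq_or_ne m l with rfl | hl
    · simp [Function.update_of_ne, hi, hij.symm, hj]
    rw [Equiv.swap_apply_of_ne_of_ne hj hl]
    simp [Function.update_of_ne, hi, hj, hl]
  bound a b c := by
    refine (RCLike.abs_re_le_norm _).trans ?_
    rw [norm_mul, hω, one_mul]
    refine (T.le_opNorm _).trans ?_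
    rw [hn, one_mul, prod_norm_update_of_norm_eq_one hx hij hil hjl]

end MultilinearForm

/-! ### The complex case: from a real plane to a complex line. -/

/-- Two unit vectors at which a complex-rotation-compatible form is almost extremal are almost
parallel. -/
theorem IsSymmTrilinearContraction.exists_norm_sub_smul_le {H : Type*} [NormedAddCommGroup H]
    [InnerProductSpace ℂ H] {F : H → H → H → ℝ} (hF : IsSymmTrilinearContraction F)
    (hI : ∀ a z, F (Complex.I • a) (Complex.I • a) z = -F a a z) {w z : H} {ε : ℝ} (hε : 0 < ε)
    (hε1 : ε ≤ 1) (hz : ‖z‖ = 1) (hw : ‖w‖ ≤ 2)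
    (h : ‖w‖ ^ 2 - ε ^ 2 * ((ε ^ 2 / 16) ^ 4 / 64) ≤ F w w z) :
    ∃ c : ℂ, ‖w - c • z‖ ≤ ε := by
  let _ : InnerProductSpace ℝ H := InnerProductSpace.complexToReal
  by_cases hwε : ‖w‖ ≤ ε
  · exact ⟨0, by simpa using hwε⟩
  push Not at hwε
  -- Makes `4 * r = (ε / 2) ^ 2`; rescaling from `u` to `w` at most doubles the distance `ε / 2`.
  set r := ε ^ 2 / 16 with hrdef
  have hr : 0 < r := by positivity
  have hr1 : r ≤ 1 := by rw [hrdef]; nlinarith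
  have h1 := hF.le_apply_normalize (r := r) hε hwε.le h
  have hw0 : ‖w‖ ≠ 0 := (hε.trans hwε).ne'
  set u := ‖w‖⁻¹ • w with hu
  have hun : ‖u‖ = 1 := by rw [hu, norm_smul, norm_inv, norm_norm, inv_mul_cancel₀ hw0]
  clear_value u
  have hIu : ‖Complex.I • u‖ = 1 := by rw [norm_smul, hun, Complex.norm_I, one_mul]
  have hkey := hF.one_sub_le_inner_sq_add_inner_sq hr hr1 hun hIu hz h1 (by rw [hI]; linarith)
  have hsq : inner ℝ u z ^ 2 + inner ℝ (Complex.I • u) z ^ 2 = ‖inner ℂ z u‖ ^ 2 := by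
    rw [real_inner_eq_re_inner ℂ, real_inner_eq_re_inner ℂ, inner_smul_left, norm_inner_symm,
      ← Complex.normSq_eq_norm_sq, Complex.normSq_apply]
    simp
    ring
  have hdist : ‖u - (inner ℂ z u : ℂ) • z‖ ≤ ε / 2 := by
    refine (sq_le_sq₀ (norm_nonneg _) (by positivity)).mp ?_
    have : ‖u - (inner ℂ z u : ℂ) • z‖ ^ 2 = 1 - ‖inner ℂ z u‖ ^ 2 := by
      rw [@norm_sub_sq ℂ, inner_smul_right, norm_smul, hun, hz, ← inner_conj_symm u z,
        RCLike.mul_conj]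
      simp
      norm_cast
      ring
    rw [this, ← hsq, div_pow]
    linarith
  refine ⟨(‖w‖ : ℂ) * inner ℂ z u, ?_⟩
  have hwu : w = (‖w‖ : ℂ) • u := by
    rw [Complex.coe_smul, hu, smul_smul, mul_inv_cancel₀ hw0, one_smul]
  have : w - ((‖w‖ : ℂ) * inner ℂ z u) • z = (‖w‖ : ℂ) • (u - (inner ℂ z u : ℂ) • z) := by
    rw [smul_sub, ← hwu, smul_smul]
  rw [this, norm_smul, Complex.norm_real, norm_norm]
  nlinarith [norm_nonneg w, norm_nonneg (u - (inner ℂ z u : ℂ) • z)]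

/-! ### Choice of the subspace and conclusion. -/

theorem Submodule.infDist_le_of_mem {𝕜 H : Type*} [RCLike 𝕜] [NormedAddCommGroup H]
    [InnerProductSpace 𝕜 H] (V : Submodule 𝕜 H) {x v : H} {ε : ℝ} (hv : v ∈ V)
    (h : ‖x - v‖ ≤ ε) : Metric.infDist x (V : Set H) ≤ ε :=
  (Metric.infDist_le_dist_of_mem hv).trans (by rwa [dist_eq_norm])

theorem exists_fin_ne_ne {k : ℕ} (hk : 3 ≤ k) (i j : Fin k) : ∃ l, l ≠ i ∧ l ≠ j := by
  have : ({i, j} : Finset (Fin k)).card < (Finset.univ : Finset (Fin k)).card := by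
    rw [Finset.card_univ, Fintype.card_fin]
    exact Finset.card_le_two.trans_lt (by omega)
  obtain ⟨l, -, hl⟩ := Finset.exists_mem_notMem_of_card_lt_card this
  exact ⟨l, by simpa using hl⟩

theorem real_almost_extremal {k : ℕ} (hk : 3 ≤ k) {ε : ℝ} (hε : 0 < ε) (hε1 : ε ≤ 1)
    {H : Type*} [NormedAddCommGroup H] [InnerProductSpace ℝ H]
    (T : ContinuousMultilinearMap ℝ (fun _ : Fin k => H) ℝ) (x : Fin k → H)
    (hT : IsSymmForm T) (hn : ‖T‖ = 1) (hx : ∀ j, ‖x j‖ = 1)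
    (h : 1 - (ε ^ 2 * ((ε ^ 2 / 4) ^ 4 / 64) / 8) ^ 2 ≤ ‖T x‖) :
    ∃ V : Submodule ℝ H, V ≤ Submodule.span ℝ (Set.range x) ∧
      Module.finrank ℝ V ≤ 2 ∧ ∀ j, Metric.infDist (x j) (V : Set H) ≤ ε := by
  obtain ⟨ω, hω, hωT⟩ := RCLike.exists_norm_eq_mul_self (T x)
  let i : Fin k := ⟨0, by omega⟩
  -- If every `x j` is close to `x i` or `-x i`, a line suffices. Otherwise some `x i ± x j` are
  -- both long enough to normalize, and this one pair serves every other index.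
  by_cases hall : ∀ j, ‖x i + x j‖ ≤ ε ∨ ‖x i - x j‖ ≤ ε
  · refine ⟨Submodule.span ℝ {x i}, Submodule.span_mono (by simp),
      (finrank_span_le_card {x i}).trans (by simp), fun j => ?_⟩
    rcases hall j with hj | hj
    · refine Submodule.infDist_le_of_mem _
        (Submodule.neg_mem _ (Submodule.mem_span_singleton_self (x i))) ?_
      rwa [sub_neg_eq_add, add_comm]
    · exact Submodule.infDist_le_of_mem _ (Submodule.mem_span_singleton_self (x i))
        (by rwa [norm_sub_rev])
  push Not at hall
  obtain ⟨j, hadd, hsub⟩ := hall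
  refine ⟨Submodule.span ℝ {x i, x j}, Submodule.span_mono ?_, ?_, fun l => ?_⟩
  · rintro _ (rfl | rfl) <;> exact Set.mem_range_self _
  · classical
    have := finrank_span_finset_le_card (R := ℝ) ({x i, x j} : Finset H)
    rw [Finset.coe_pair] at this
    exact this.trans Finset.card_le_two
  have hij : i ≠ j := by
    intro e
    rw [← e, sub_self, norm_zero] at hsub
    exact hsub.not_gt hε
  rcases eq_or_ne i l with rfl | hil
  · exact Submodule.infDist_le_of_mem _ (Submodule.subset_span (Set.mem_insert _ _))
      (by simpa using hε.le)
  rcases eq_or_ne j l with rfl | hjl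
  · exact Submodule.infDist_le_of_mem _ (v := x j) (Submodule.subset_span (by simp))
      (by simpa using hε.le)
  obtain ⟨a, b, hab⟩ := (hT.isSymmTrilinearContraction hn hx hij hil hjl hω).exists_norm_sub_le
    hε hε1 (hx i) (hx j) (hx l) hadd.le hsub.le (by
      simp only [Function.update_eq_self]
      rw [← hωT]
      simpa using h)
  exact Submodule.infDist_le_of_mem _ (Submodule.mem_span_pair.mpr ⟨a, b, rfl⟩) hab

theorem complex_almost_extremal {k : ℕ} (hk : 3 ≤ k) {ε : ℝ} (hε : 0 < ε) (hε1 : ε ≤ 1)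
    {H : Type*} [NormedAddCommGroup H] [InnerProductSpace ℂ H]
    (T : ContinuousMultilinearMap ℂ (fun _ : Fin k => H) ℂ) (x : Fin k → H)
    (hT : IsSymmForm T) (hn : ‖T‖ = 1) (hx : ∀ j, ‖x j‖ = 1)
    (h : 1 - (ε ^ 2 * ((ε ^ 2 / 16) ^ 4 / 64) / 8) ^ 2 ≤ ‖T x‖) :
    ∃ V : Submodule ℂ H, V ≤ Submodule.span ℂ (Set.range x) ∧
      Module.finrank ℂ V = 1 ∧ ∀ j, Metric.infDist (x j) (V : Set H) ≤ ε := by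
  let _ : InnerProductSpace ℝ H := InnerProductSpace.complexToReal
  obtain ⟨ω, hω, hωT⟩ := RCLike.exists_norm_eq_mul_self (T x)
  let l : Fin k := ⟨0, by omega⟩
  refine ⟨Submodule.span ℂ {x l}, Submodule.span_mono (by simp),
    finrank_span_singleton (norm_ne_zero_iff.mp (by simp [hx])), fun i => ?_⟩
  rcases eq_or_ne i l with rfl | hil
  · exact Submodule.infDist_le_of_mem _ (Submodule.mem_span_singleton_self _)
      (by simpa using hε.le)
  obtain ⟨j, hji, hjl⟩ := exists_fin_ne_ne hk i l
  have hF := hT.isSymmTrilinearContraction hn hx hji.symm hil hjl hω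
  set F : H → H → H → ℝ := fun a b c => RCLike.re
      (ω * T (Function.update (Function.update (Function.update x l c) j b) i a)) with hFdef
  have hI : ∀ a z, F (Complex.I • a) (Complex.I • a) z = -F a a z := by
    intro a z
    simp only [hFdef]
    rw [T.map_update_smul, Function.update_comm hji, T.map_update_smul, Function.update_comm hji,
      smul_smul, Complex.I_mul_I, neg_one_smul, mul_neg, map_neg]
  have hFx : 1 - (ε ^ 2 * ((ε ^ 2 / 16) ^ 4 / 64) / 8) ^ 2 ≤ F (x i) (x j) (x l) := by
    simp only [hFdef, Function.update_eq_self]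
    rw [← hωT]
    simpa using h
  have hs1 : ε ^ 2 * ((ε ^ 2 / 16) ^ 4 / 64) / 8 ≤ 1 := by
    have hε2 : ε ^ 2 ≤ 1 := pow_le_one₀ hε.le hε1
    have hr4 : (ε ^ 2 / 16) ^ 4 ≤ 1 := pow_le_one₀ (by positivity) (by linarith)
    nlinarith [mul_le_mul hε2 hr4 (by positivity) zero_le_one]
  obtain ⟨h1, h2⟩ := hF.le_apply_add_add (by positivity) hs1 (hx i) (hx j) (hx l) hFx
  have hIsub : F (Complex.I • (x i - x j)) (Complex.I • (x i - x j)) (x l)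
      = -F (x i - x j) (x i - x j) (x l) := hI _ _
  have hadd2 : ‖x i + x j‖ ≤ 2 := (norm_add_le _ _).trans (by rw [hx, hx]; norm_num)
  have hsub2 : ‖Complex.I • (x i - x j)‖ = ‖x i - x j‖ := by
    rw [norm_smul, Complex.norm_I, one_mul]
  obtain ⟨a, ha⟩ := hF.exists_norm_sub_smul_le hI hε hε1 (hx l) hadd2 (by linarith)
  -- `F` is almost minimal in the direction `x i - x j`; multiplying by `i` flips the sign, so the
  -- same lemma applies.
  obtain ⟨b, hb⟩ := hF.exists_norm_sub_smul_le hI (w := Complex.I • (x i - x j)) hε hε1 (hx l)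
    (by rw [hsub2]; exact (norm_sub_le _ _).trans (by rw [hx, hx]; norm_num))
    (by rw [hsub2, hIsub]; linarith)
  refine Submodule.infDist_le_of_mem _
    (Submodule.smul_mem _ ((a - Complex.I * b) / 2) (Submodule.mem_span_singleton_self (x l))) ?_
  have hsplit : x i - ((a - Complex.I * b) / 2) • x l
      = (1 / 2 : ℂ) • (x i + x j - a • x l)
        + (-Complex.I / 2) • (Complex.I • (x i - x j) - b • x l) := by
    have e : (-Complex.I / 2) • (Complex.I • (x i - x j)) = (1 / 2 : ℂ) • (x i - x j) := by
      rw [smul_smul, div_mul_eq_mul_div, neg_mul, Complex.I_mul_I, neg_neg]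
    rw [smul_sub (-Complex.I / 2), e]
    module
  rw [hsplit]
  refine (norm_add_le _ _).trans ?_
  rw [norm_smul, norm_smul]
  have e1 : ‖(1 / 2 : ℂ)‖ = 1 / 2 := by norm_num
  have e2 : ‖-Complex.I / 2‖ = 1 / 2 := by simp
  rw [e1, e2]
  linarith

theorem mainTheorem4 (k : ℕ) (hk : 3 ≤ k) (ε : ℝ) (hε : 0 < ε) :
    ∃ β : ℝ, 0 < β ∧
      (∀ (H : Type u) [NormedAddCommGroup H] [InnerProductSpace ℝ H] [CompleteSpace H]
        (T : ContinuousMultilinearMap ℝ (fun _ : Fin k => H) ℝ) (x : Fin k → H),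
        IsSymmForm T → ‖T‖ = 1 → (∀ j, ‖x j‖ = 1) → 1 - β < ‖T x‖ →
          ∃ V : Submodule ℝ H, V ≤ Submodule.span ℝ (Set.range x) ∧
            Module.finrank ℝ V ≤ 2 ∧ ∀ j, Metric.infDist (x j) (V : Set H) ≤ ε) ∧
      (∀ (H : Type u) [NormedAddCommGroup H] [InnerProductSpace ℂ H] [CompleteSpace H]
        (T : ContinuousMultilinearMap ℂ (fun _ : Fin k => H) ℂ) (x : Fin k → H),
        IsSymmForm T → ‖T‖ = 1 → (∀ j, ‖x j‖ = 1) → 1 - β < ‖T x‖ →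
          ∃ V : Submodule ℂ H, V ≤ Submodule.span ℂ (Set.range x) ∧
            Module.finrank ℂ V = 1 ∧ ∀ j, Metric.infDist (x j) (V : Set H) ≤ ε) := by
  -- The quantitative estimates require a tolerance at most 1.
  have hδ : 0 < min ε 1 := lt_min hε one_pos
  set δ := min ε 1
  have hδ1 : δ ≤ 1 := min_le_right _ _
  have hδε : δ ≤ ε := min_le_left _ _
  refine ⟨min ((δ ^ 2 * ((δ ^ 2 / 4) ^ 4 / 64) / 8) ^ 2)
    ((δ ^ 2 * ((δ ^ 2 / 16) ^ 4 / 64) / 8) ^ 2), by positivity, ?_, ?_⟩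
  · intro H _ _ _ T x hT hn hx h
    obtain ⟨V, h1, h2, h3⟩ := real_almost_extremal hk hδ hδ1 T x hT hn hx
      ((sub_le_sub_left (min_le_left _ _) _).trans h.le)
    exact ⟨V, h1, h2, fun j => (h3 j).trans hδε⟩
  · intro H _ _ _ T x hT hn hx h
    obtain ⟨V, h1, h2, h3⟩ := complex_almost_extremal hk hδ hδ1 T x hT hn hx
      ((sub_le_sub_left (min_le_right _ _) _).trans h.le)
    exact ⟨V, h1, h2, fun j => (h3 j).trans hδε⟩
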